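/- Let $G$ be a finite unweighted (simple, undirected) graph on $n$ vertices, let $k\ge 1$ be an integer, and let $t,t'$ be integers with $\sqrt k\le t,t'\le a\sqrt k$ for a fixed constant $a$ (for instance $t=t'=\lceil\sqrt k\rceil$). Consider the following randomized parallel algorithm. *First phase.* Start with every vertex being a cluster of its own (with itself as its centre), all edges of $G$ unprocessed, and an empty spanner. Repeat the following iteration $t$ times. (1) Sample each current cluster independently with probability $n^{-1/k}$. (2) In parallel, each vertex $v$ that lies in no sampled cluster does the following. If unprocessed edges connect $v$ to some sampled cluster, then $v$ joins one such cluster $c$, adds one unprocessed edge between $v$ and $c$ to the spanner, and all edges between $v$ and $c$ cease to be unprocessed. Otherwise $v$ adds, for each cluster $c'$ to which it is connected by unprocessed edges, one of these edges to the spanner, all edges between $v$ and $c'$ cease to be unprocessed, and $v$ belongs to no cluster from then on. The new clusters are the sampled clusters together with the vertices that joined them. (3) All edges inside a new cluster cease to be unprocessed. *Second phase.* Form the quotient graph $\hat G$, whose vertices are the clusters after the $t$ iterations, two distinct clusters being adjacent if an edge of $G$ connects them. Run a spanner algorithm with parameter $t'$ on $\hat G$ and, for each edge that it returns, add one edge of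 $G$ between the two corresponding clusters to the spanner. The spanner algorithm in the second phase is either the Baswana–Sen algorithm with parameter $t'$ (on an $N$-vertex graph: $t'-1$ iterations as above with sampling probability $N^{-1/t'}$, after which every vertex adds one unprocessed edge to each cluster to which unprocessed edges connect it), or any randomized algorithm that on every finite graph, with $N$ vertices say, always returns a $(2t'-1)$-spanner within $B\,t'$ rounds, with at most $B\,t'N^{1+1/t'}$ edges in expectation, for a constant $B$. Each of the following counts as one parallel round: sampling the clusters; step (2) for all vertices; step (3); the contraction to $\hat G$; adding the edges of $G$ that correspond to the edges of the spanner of $\hat G$; the last step of the Baswana–Sen algorithm. Arbitrary choices are resolved by taking the least identifier, with respect to an arbitrary linear order on the vertices. Then there is a constant $C$, depending only on $a$ (and on $B$, for a general spanner algorithm in the second phase), such that the algorithm always returns a spanning subgraph $H$ of $G$ with $d_H(u,v)\le C\,k\,d_G(u,v)$ for all vertices $u,v$ that are connected in $G$, always within $C\sqrt k$ rounds, and such that the expected number of edges of $H$ is at most $C\sqrt k\,n^{1+1/k}$. -/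

import Mathlib

open scoped ENNReal

universe u

noncomputable section

namespace ClusterSpanner

/-! ### Spanners -/

/-- `H` is a spanner of `G` with stretch `s`: a spanning subgraph in which the distance between any
two vertices is at most `s` times their distance in `G` (in particular it stays finite). -/
def IsSpanner {V : Type u} (G H : SimpleGraph V) (s : ℝ) : Prop :=
  H ≤ G ∧ ∀ u v : V, G.Reachable u v →
    H.Reachable u v ∧ (H.dist u v : ℝ) ≤ s * (G.dist u v : ℝ)

/-! ### Randomized parallel computations

A randomized parallel computation with results in `α` is a distribution on pairs consisting of a
result and the number of parallel rounds that were used to obtain it. -/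

/-- Draw from `μ` (or perform a deterministic operation, if `μ` is a point mass), in one round. -/
def oneRound {α : Type u} (μ : PMF α) : PMF (α × ℕ) :=
  μ.map fun x => (x, 1)

/-- Sequential composition; the numbers of rounds add up. -/
def andThen {α β : Type u} (μ : PMF (α × ℕ)) (f : α → PMF (β × ℕ)) : PMF (β × ℕ) :=
  μ.bind fun x => (f x.1).map fun y => (y.1, x.2 + y.2)

/-- The expected number of edges of the graph returned by a computation. -/
def expectedSize {V : Type u} (μ : PMF (SimpleGraph V × ℕ)) : ℝ≥0∞ :=
  ∑' x : SimpleGraph V × ℕ, μ x * (x.1.edgeSet.ncard : ℝ≥0∞)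

/-- For every outcome of the random choices the computation returns a spanner of `G` with the given
stretch within the given number of rounds, and the expected number of edges of that spanner is at
most `size`. -/
def ComputesSpanner {V : Type u} (G : SimpleGraph V) (μ : PMF (SimpleGraph V × ℕ))
    (stretch size rounds : ℝ) : Prop :=
  (∀ x ∈ μ.support, IsSpanner G x.1 stretch ∧ (x.2 : ℝ) ≤ rounds) ∧
    expectedSize μ ≤ ENNReal.ofReal size

/-! ### Sampling -/

/-- A random subset of `S` that contains each element of `S` independently with probability `p`. -/
def randomSubset {V : Type u} (S : Finset V) (p : ℝ≥0∞) (hp : p ≤ 1) : PMF (Finset V) :=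
  open scoped Classical in
  PMF.ofFinset (fun R => if R ⊆ S then p ^ R.card * (1 - p) ^ (S.card - R.card) else 0) S.powerset
    (by
      rw [Finset.sum_congr rfl (g := fun R => p ^ R.card * (1 - p) ^ (S.card - R.card))
        (fun R hR => if_pos (Finset.mem_powerset.1 hR)), Finset.sum_pow_mul_eq_add_pow,
        add_tsub_cancel_of_le hp, one_pow])
    (fun R hR => if_neg fun h => hR (Finset.mem_powerset.2 h))

/-- The sampling probability `n ^ (-1 / k)`. -/
def sampleProb (n k : ℕ) : ℝ≥0∞ :=
  ENNReal.ofReal ((n : ℝ) ^ (-(1 / (k : ℝ))))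

theorem sampleProb_le_one (n k : ℕ) : sampleProb n k ≤ 1 := by
  unfold sampleProb
  rw [ENNReal.ofReal_le_one]
  rcases Nat.eq_zero_or_pos n with rfl | hn
  · by_cases h : -(1 / (k : ℝ)) = 0
    · rw [h, Real.rpow_zero]
    · rw [Nat.cast_zero, Real.zero_rpow h]; exact zero_le_one
  · exact Real.rpow_le_one_of_one_le_of_nonpos (by exact_mod_cast hn)
      (neg_nonpos.2 (by positivity))

/-! ### Clusterings and the Baswana-Sen iteration

Vertices carry a linear order (their identifiers). Whenever an arbitrary cluster or an arbitrary
edge has to be picked, the one with the least identifier is taken. -/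

/-- The state of the clustering process. -/
structure State (V : Type u) where
  /-- the edges that are not yet settled -/
  unprocessed : SimpleGraph V
  /-- the edges added to the spanner so far -/
  spanner : SimpleGraph V
  /-- the centre of the cluster that contains the given vertex; `none` if no cluster does.
  A cluster is named by its centre. -/
  clusterOf : V → Option V

namespace State

variable {V : Type u}

/-- All edges are unprocessed, the spanner is empty, every vertex is a cluster of its own. -/
def init (G : SimpleGraph V) : State V where
  unprocessed := G
  spanner := ⊥
  clusterOf := some

/-- The current clusters (their centres). -/
def clusters [Fintype V] (s : State V) : Finset V :=
  open scoped Classical in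
  Finset.univ.filter fun c => ∃ v, s.clusterOf v = some c

/-- The other endpoints of the unprocessed edges between the vertex `v` and the cluster `c`. -/
def edgesTo (s : State V) (v c : V) : Set V :=
  {u | s.unprocessed.Adj v u ∧ s.clusterOf u = some c}

/-- The clusters adjacent to the vertex `v` through unprocessed edges. -/
def adjClusters [Fintype V] (s : State V) (v : V) : Finset V :=
  open scoped Classical in
  Finset.univ.filter fun c => (s.edgesTo v c).Nonempty

/-- One edge between `v` and `c`, for each vertex `v` and each cluster `c ∈ A v`. -/
def oneEdgeEach [LinearOrder V] (s : State V) (A : V → Finset V) : SimpleGraph V :=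
  SimpleGraph.fromRel fun v u => ∃ c ∈ A v, IsLeast (s.edgesTo v c) u

/-- The vertex `v` lies in one of the sampled clusters `R`. -/
def InSampled (s : State V) (R : Finset V) (v : V) : Prop :=
  ∃ c ∈ R, s.clusterOf v = some c

/-- The sampled cluster that `v` joins, if `v` is adjacent to a sampled cluster. -/
def joinTarget [Fintype V] [LinearOrder V] (s : State V) (R : Finset V) (v : V) : Option V :=
  if h : (s.adjClusters v ∩ R).Nonempty then some ((s.adjClusters v ∩ R).min' h) else none

/-- The clusters `c` for which `v` keeps one edge to `c` and settles all its edges to `c`: none if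
`v` lies in a sampled cluster, otherwise only the cluster that `v` joins, or all adjacent clusters
if `v` is adjacent to no sampled cluster. -/
def settled [Fintype V] [LinearOrder V] (s : State V) (R : Finset V) (v : V) : Finset V :=
  open scoped Classical in
  if s.InSampled R v then ∅
  else match s.joinTarget R v with
    | some c => {c}
    | none => s.adjClusters v

/-- All vertices in parallel: vertices of sampled clusters stay, the other ones join an adjacent
sampled cluster, or else leave the clustering; edges are added to the spanner and discarded
according to `settled`. -/
def grow [Fintype V] [LinearOrder V] (s : State V) (R : Finset V) : State V where
  unprocessed := s.unprocessed \
    SimpleGraph.fromRel fun v u => ∃ c ∈ s.settled R v, u ∈ s.edgesTo v c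
  spanner := s.spanner ⊔ s.oneEdgeEach (s.settled R)
  clusterOf v :=
    open scoped Classical in
    if s.InSampled R v then s.clusterOf v else s.joinTarget R v

/-- Discard the unprocessed edges inside clusters. -/
def removeInternal (s : State V) : State V where
  unprocessed := s.unprocessed \
    SimpleGraph.fromRel fun v u => ∃ c, s.clusterOf v = some c ∧ s.clusterOf u = some c
  spanner := s.spanner
  clusterOf := s.clusterOf

/-- One iteration: sampling the clusters, growing the sampled ones and removing the internal edges
take one round each. -/
def iteration [Fintype V] [LinearOrder V] (p : ℝ≥0∞) (hp : p ≤ 1) (s : State V) :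
    PMF (State V × ℕ) :=
  andThen (oneRound (randomSubset s.clusters p hp)) fun R =>
  andThen (oneRound (PMF.pure (s.grow R))) fun s' =>
  oneRound (PMF.pure s'.removeInternal)

/-- A number of successive iterations. -/
def iterations [Fintype V] [LinearOrder V] (p : ℝ≥0∞) (hp : p ≤ 1) :
    ℕ → State V → PMF (State V × ℕ)
  | 0, s => PMF.pure (s, 0)
  | i + 1, s => andThen (iteration p hp s) (iterations p hp i)

end State

/-! ### Spanner routines -/

/-- A randomized parallel routine that returns, for each finite graph, a graph on the same
vertices. -/
abbrev SpannerRoutine : Type (u + 1) :=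
  ∀ (W : Type u) [Fintype W] [LinearOrder W], SimpleGraph W → PMF (SimpleGraph W × ℕ)

/-- On every finite graph, with `N` vertices say, the routine computes a spanner of stretch
`2 * r - 1` and expected size at most `B * r * N ^ (1 + 1 / r)` in at most `B * r` rounds. -/
def SpannerRoutine.HasGuarantee (P : SpannerRoutine.{u}) (B : ℝ) (r : ℕ) : Prop :=
  ∀ (W : Type u) [Fintype W] [LinearOrder W] (H : SimpleGraph W),
    ComputesSpanner H (P W H) (2 * (r : ℝ) - 1)
      (B * (r : ℝ) * (Fintype.card W : ℝ) ^ (1 + 1 / (r : ℝ))) (B * (r : ℝ))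

/-- The Baswana-Sen algorithm with parameter `r`: `r - 1` iterations with sampling probability
`N ^ (-1 / r)`, and a last round in which every vertex keeps one unprocessed edge to each of its
adjacent clusters. -/
def baswanaSen (r : ℕ) : SpannerRoutine.{u} := fun W _ _ H =>
  andThen (State.iterations (sampleProb (Fintype.card W) r) (sampleProb_le_one _ _) (r - 1)
    (State.init H)) fun s =>
  oneRound (PMF.pure (s.spanner ⊔ s.oneEdgeEach s.adjClusters))

/-! ### Contraction -/

/-- The quotient graph: its vertices are the clusters, two distinct ones being adjacent if an edge
of `G` connects them. -/
def quotientGraph {V : Type u} [Fintype V] (G : SimpleGraph V) (s : State V) :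
    SimpleGraph {c : V // c ∈ s.clusters} :=
  SimpleGraph.fromRel fun c d =>
    ∃ v u, G.Adj v u ∧ s.clusterOf v = some c.1 ∧ s.clusterOf u = some d.1

/-- For each edge of a graph `H` on the clusters, say between `c < d`, one edge `{v, u}` of `G` with
`v` in the cluster `c` and `u` in the cluster `d`. -/
def liftEdges {V : Type u} [Fintype V] [LinearOrder V] (G : SimpleGraph V) (s : State V)
    (H : SimpleGraph {c : V // c ∈ s.clusters}) : SimpleGraph V :=
  SimpleGraph.fromRel fun v u => ∃ c d, H.Adj c d ∧ c < d ∧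
    IsLeast {v' | s.clusterOf v' = some c.1 ∧ ∃ u', G.Adj v' u' ∧ s.clusterOf u' = some d.1} v ∧
    IsLeast {u' | G.Adj v u' ∧ s.clusterOf u' = some d.1} u

/-- The cluster-contraction algorithm: `t` iterations with sampling probability `n ^ (-1 / k)`, one
round for the contraction of the clusters, a run of `P` on the quotient graph, and one round to add
an edge of `G` for each edge returned by `P`. -/
def clusterContraction (k t : ℕ) (P : SpannerRoutine.{u}) {V : Type u} [Fintype V] [LinearOrder V]
    (G : SimpleGraph V) : PMF (SimpleGraph V × ℕ) :=
  andThen (State.iterations (sampleProb (Fintype.card V) k) (sampleProb_le_one _ _) t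
    (State.init G)) fun s =>
  andThen (oneRound (PMF.pure (quotientGraph G s))) fun Q =>
  andThen (P {c : V // c ∈ s.clusters} Q) fun H =>
  oneRound (PMF.pure (s.spanner ⊔ liftEdges G s H))

end ClusterSpanner

end

noncomputable section

namespace ClusterSpanner

/-! ### Expectations -/

/-! Let `p = n ^ (-1/k)` and let `r` be the second-phase parameter.

Stretch and rounds hold for every outcome of the sampling. The invariant `HasRadius` says that after
`i` iterations clusters have radius at most `i` in the spanner, processed edges have stretch at most
`2 * i`, and unprocessed edges join clustered vertices. After `t` iterations an edge of the quotient
spanner lifts to a path of length at most `2 * t + 1` between centres, so an unprocessed edge is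
bridged by `t + (2 * r - 1) * (2 * t + 1) + t` steps (`isSpanner_contraction`), which is `O(t * r) =
O(k)`.

Size of the first phase: a vertex with `d` adjacent clusters adds more than one edge only if none of
them is sampled, so it adds at most `1 + d * (1 - p) ^ d ≤ 1 + 1/p` edges in expectation. This gives
`O(n ^ (1 + 1/k))` edges per iteration (`expect_size_iteration`).

Size of the second phase: the guarantee is superlinear in the number `N` of clusters, so the mean of
`N` alone does not suffice. The first two factorial moments of `N` are at most `m` and `m ^ 2` with
`m = n ^ (1 - t/k)`, and `N ^ (1 + 1/r)` is interpolated between them (`natCast_rpow_one_add_le`).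
Since `k ≤ t * r`, the resulting expectation is at most `2 * n` (`expect_card_clusters_rpow_le`). -/

/-- The expectation of a nonnegative function of a random variable. -/
def expect {α : Type*} (μ : PMF α) (f : α → ℝ≥0∞) : ℝ≥0∞ :=
  ∑' x, μ x * f x

theorem expect_pure {α : Type*} (a : α) (f : α → ℝ≥0∞) : expect (PMF.pure a) f = f a := by
  classical
  unfold expect
  rw [tsum_eq_single a (fun b hb => by simp [hb])]
  simp

theorem expect_bind {α β : Type*} (μ : PMF α) (q : α → PMF β) (f : β → ℝ≥0∞) :
    expect (μ.bind q) f = expect μ fun a => expect (q a) f := by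
  simp only [expect, PMF.bind_apply, ← ENNReal.tsum_mul_left, ← ENNReal.tsum_mul_right]
  rw [ENNReal.tsum_comm]
  simp only [mul_assoc]

theorem expect_map {α β : Type*} (μ : PMF α) (g : α → β) (f : β → ℝ≥0∞) :
    expect (μ.map g) f = expect μ (f ∘ g) := by
  simp only [PMF.map, expect_bind, expect_pure, Function.comp_def]

theorem expect_mono {α : Type*} (μ : PMF α) {f g : α → ℝ≥0∞} (h : ∀ a, f a ≤ g a) :
    expect μ f ≤ expect μ g :=
  ENNReal.tsum_le_tsum fun a => mul_le_mul_right (h a) _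

theorem expect_mono_support {α : Type*} (μ : PMF α) {f g : α → ℝ≥0∞}
    (h : ∀ a ∈ μ.support, f a ≤ g a) : expect μ f ≤ expect μ g := by
  refine ENNReal.tsum_le_tsum fun a => ?_
  by_cases ha : μ a = 0
  · simp [ha]
  · exact mul_le_mul_right (h a ((PMF.mem_support_iff _ _).2 ha)) _

theorem expect_add {α : Type*} (μ : PMF α) (f g : α → ℝ≥0∞) :
    expect μ (fun a => f a + g a) = expect μ f + expect μ g := by
  simp only [expect, mul_add, ENNReal.tsum_add]

theorem expect_const {α : Type*} (μ : PMF α) (c : ℝ≥0∞) : expect μ (fun _ => c) = c := by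
  simp only [expect, ENNReal.tsum_mul_right, PMF.tsum_coe, one_mul]

theorem expect_const_mul {α : Type*} (μ : PMF α) (c : ℝ≥0∞) (f : α → ℝ≥0∞) :
    expect μ (fun a => c * f a) = c * expect μ f := by
  simp only [expect, ← ENNReal.tsum_mul_left, mul_left_comm]

theorem expect_sum {α ι : Type*} (μ : PMF α) (s : Finset ι) (f : ι → α → ℝ≥0∞) :
    expect μ (fun a => ∑ i ∈ s, f i a) = ∑ i ∈ s, expect μ (f i) := by
  classical
  induction s using Finset.induction_on with
  | empty => simp [expect]
  | insert i s hi ih => simp only [Finset.sum_insert hi, expect_add, ih]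

theorem expect_andThen {α β : Type u} (μ : PMF (α × ℕ)) (q : α → PMF (β × ℕ))
    (f : β → ℝ≥0∞) :
    expect (andThen μ q) (fun y => f y.1) =
      expect μ fun x => expect (q x.1) fun y => f y.1 := by
  simp only [andThen, expect_bind, expect_map, Function.comp_def]

theorem expect_oneRound {α : Type u} (μ : PMF α) (f : α → ℝ≥0∞) :
    expect (oneRound μ) (fun y => f y.1) = expect μ f := by
  simp only [oneRound, expect_map, Function.comp_def]

theorem mem_support_andThen {α β : Type u} {μ : PMF (α × ℕ)} {q : α → PMF (β × ℕ)}
    {y : β × ℕ} :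
    y ∈ (andThen μ q).support ↔
      ∃ x ∈ μ.support, ∃ z ∈ (q x.1).support, (z.1, x.2 + z.2) = y := by
  simp only [andThen, PMF.mem_support_bind_iff, PMF.mem_support_map_iff]

theorem mem_support_oneRound_pure {α : Type u} {a : α} {y : α × ℕ} :
    y ∈ (oneRound (PMF.pure a)).support ↔ y = (a, 1) := by
  simp [oneRound, PMF.pure_map]

/-! ### Random subsets -/

section RandomSubset

variable {V : Type u} (S : Finset V) (p : ℝ≥0∞) (hp : p ≤ 1)

theorem expect_randomSubset (f : Finset V → ℝ≥0∞) :
    expect (randomSubset S p hp) f =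
      ∑ R ∈ S.powerset, p ^ R.card * (1 - p) ^ (S.card - R.card) * f R := by
  classical
  unfold expect
  rw [tsum_eq_sum (s := S.powerset)]
  · refine Finset.sum_congr rfl fun R hR => ?_
    simp only [randomSubset, PMF.ofFinset_apply]
    rw [if_pos (Finset.mem_powerset.1 hR)]
  · intro R hR
    simp only [randomSubset, PMF.ofFinset_apply]
    rw [if_neg fun h => hR (Finset.mem_powerset.2 h), zero_mul]

theorem subset_of_mem_support_randomSubset {R : Finset V}
    (hR : R ∈ (randomSubset S p hp).support) : R ⊆ S := by
  classical
  have := ((PMF.mem_support_ofFinset_iff _ _ _).1 hR).1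
  exact Finset.mem_powerset.1 this

/-- The probability that all elements of `A` are sampled. -/
theorem expect_subset_randomSubset [DecidableEq V] {A : Finset V} (hA : A ⊆ S) :
    expect (randomSubset S p hp) (fun R => if A ⊆ R then 1 else 0) = p ^ A.card := by
  -- The sets containing `A` are the `A ∪ T` with `T ⊆ S \ A`; factoring out `p ^ A.card` leaves the
  -- binomial expansion of `(p + (1 - p)) ^ (S \ A).card = 1`.
  have hfilter : S.powerset.filter (A ⊆ ·) = (S \ A).powerset.image (A ∪ ·) := by
    rw [← Finset.Icc_eq_image_powerset hA]
    ext R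
    simp [and_comm]
  rw [expect_randomSubset]
  simp only [mul_ite, mul_one, mul_zero]
  rw [← Finset.sum_filter, hfilter, Finset.sum_image]
  · have h : ∀ T ∈ (S \ A).powerset,
        p ^ (A ∪ T).card * (1 - p) ^ (S.card - (A ∪ T).card) =
          p ^ A.card * (p ^ T.card * (1 - p) ^ ((S \ A).card - T.card)) := by
      intro T hT
      have hd : Disjoint A T :=
        Finset.disjoint_sdiff.mono_right (Finset.mem_powerset.1 hT)
      rw [Finset.card_union_of_disjoint hd, Finset.card_sdiff_of_subset hA, Nat.sub_sub, pow_add,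
        mul_assoc]
    rw [Finset.sum_congr rfl h, ← Finset.mul_sum, Finset.sum_pow_mul_eq_add_pow,
      add_tsub_cancel_of_le hp, one_pow, mul_one]
  · intro T hT T' hT' h
    have hd : ∀ T ∈ (S \ A).powerset, Disjoint A T := fun T hT =>
      Finset.disjoint_sdiff.mono_right (Finset.mem_powerset.1 hT)
    have h1 := Finset.union_sdiff_cancel_left (hd T hT)
    have h2 := Finset.union_sdiff_cancel_left (hd T' hT')
    rw [← h1, ← h2]
    exact congrArg (· \ A) h

/-- The probability that no element of `A` is sampled. -/
theorem expect_disjoint_randomSubset [DecidableEq V] {A : Finset V} (hA : A ⊆ S) :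
    expect (randomSubset S p hp) (fun R => if Disjoint A R then 1 else 0) =
      (1 - p) ^ A.card := by
  have hfilter : S.powerset.filter (Disjoint A ·) = (S \ A).powerset := by
    ext R
    simp only [Finset.mem_filter, Finset.mem_powerset, Finset.subset_sdiff, disjoint_comm]
  rw [expect_randomSubset]
  simp only [mul_ite, mul_one, mul_zero]
  rw [← Finset.sum_filter, hfilter]
  have h : ∀ T ∈ (S \ A).powerset,
      p ^ T.card * (1 - p) ^ (S.card - T.card) =
        (1 - p) ^ A.card * (p ^ T.card * (1 - p) ^ ((S \ A).card - T.card)) := by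
    intro T hT
    have h1 := Finset.card_le_card (Finset.mem_powerset.1 hT)
    have h2 := Finset.card_le_card hA
    have h3 := Finset.card_sdiff_of_subset hA
    rw [mul_left_comm, ← pow_add]
    congr 2
    omega
  rw [Finset.sum_congr rfl h, ← Finset.mul_sum, Finset.sum_pow_mul_eq_add_pow,
    add_tsub_cancel_of_le hp, one_pow, mul_one]

theorem expect_card_randomSubset :
    expect (randomSubset S p hp) (fun R => (R.card : ℝ≥0∞)) = p * S.card := by
  classical
  have h : ∀ R ∈ (randomSubset S p hp).support,
      (R.card : ℝ≥0∞) = ∑ x ∈ S, if {x} ⊆ R then 1 else 0 := by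
    intro R hR
    simp only [Finset.singleton_subset_iff, Finset.sum_boole]
    rw [Finset.filter_mem_eq_inter,
      Finset.inter_eq_right.2 (subset_of_mem_support_randomSubset S p hp hR)]
  rw [(expect_mono_support _ fun R hR => (h R hR).le).antisymm
    (expect_mono_support _ fun R hR => (h R hR).ge), expect_sum,
    Finset.sum_congr rfl fun x hx =>
      expect_subset_randomSubset S p hp (Finset.singleton_subset_iff.2 hx)]
  simp [mul_comm]

/-- The second factorial moment of the number of sampled elements. -/
theorem expect_card_mul_pred_randomSubset :
    expect (randomSubset S p hp) (fun R => ((R.card * (R.card - 1) : ℕ) : ℝ≥0∞)) =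
      p ^ 2 * ((S.card * (S.card - 1) : ℕ) : ℝ≥0∞) := by
  classical
  have hcard : ∀ R : Finset V, R.card * (R.card - 1) = R.offDiag.card := fun R => by
    rw [Finset.offDiag_card, Nat.mul_sub_one]
  have h : ∀ R ∈ (randomSubset S p hp).support,
      ((R.card * (R.card - 1) : ℕ) : ℝ≥0∞) =
        ∑ x ∈ S.offDiag, if {x.1, x.2} ⊆ R then 1 else 0 := by
    intro R hR
    have hRS := subset_of_mem_support_randomSubset S p hp hR
    rw [hcard, Finset.sum_boole]
    congr 2
    ext x
    simp only [Finset.mem_offDiag, Finset.mem_filter, Finset.insert_subset_iff,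
      Finset.singleton_subset_iff]
    exact ⟨fun h => ⟨⟨hRS h.1, hRS h.2.1, h.2.2⟩, h.1, h.2.1⟩, fun h => ⟨h.2.1, h.2.2, h.1.2.2⟩⟩
  rw [(expect_mono_support _ fun R hR => (h R hR).le).antisymm
    (expect_mono_support _ fun R hR => (h R hR).ge), expect_sum, hcard]
  have h2 : ∀ x ∈ S.offDiag,
      expect (randomSubset S p hp) (fun R => if {x.1, x.2} ⊆ R then 1 else 0) = p ^ 2 := by
    intro x hx
    rw [Finset.mem_offDiag] at hx
    rw [expect_subset_randomSubset S p hp (A := {x.1, x.2})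
      (by simp [Finset.insert_subset_iff, hx.1, hx.2.1]), Finset.card_pair hx.2.2]
  rw [Finset.sum_congr rfl h2]
  simp [mul_comm]

end RandomSubset

/-- The expected contribution of an event that avoids `d` samples of probability `p`. -/
theorem nat_mul_one_sub_pow_le_inv {p : ℝ≥0∞} (hp : p ≤ 1) (d : ℕ) :
    (d : ℝ≥0∞) * (1 - p) ^ d ≤ p⁻¹ := by
  have hq : (1 - p) + p = 1 := tsub_add_cancel_of_le hp
  -- A Bernoulli-type inequality; dropping the summand `1` in the second factor gives the claim.
  have key : ∀ d : ℕ, (1 - p) ^ d * (1 + d * p) ≤ 1 := by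
    intro d
    induction d with
    | zero => simp
    | succ d ih =>
      refine le_trans ?_ ih
      rw [pow_succ, mul_assoc]
      refine mul_le_mul_right ?_ _
      have hq1 : 1 - p ≤ 1 := tsub_le_self
      calc (1 - p) * (1 + ((d + 1 : ℕ) : ℝ≥0∞) * p)
          = (1 - p) + (1 - p) * p + (1 - p) * (d * p) := by push_cast; ring
        _ ≤ (1 - p) + 1 * p + 1 * (d * p) := by gcongr
        _ = 1 + d * p := by rw [one_mul, one_mul, hq]
  rw [ENNReal.le_inv_iff_mul_le]
  refine le_trans ?_ (key d)
  calc (d : ℝ≥0∞) * (1 - p) ^ d * p = (1 - p) ^ d * (d * p) := by ring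
    _ ≤ _ := by gcongr; exact le_add_self

/-! ### Sizes of the graphs and of the clusterings -/

namespace State

variable {V : Type u}

theorem mem_clusters [Fintype V] (s : State V) (c : V) :
    c ∈ s.clusters ↔ ∃ v, s.clusterOf v = some c := by
  simp [clusters]

theorem mem_adjClusters [Fintype V] (s : State V) (v c : V) :
    c ∈ s.adjClusters v ↔ (s.edgesTo v c).Nonempty := by
  simp [adjClusters]

theorem adjClusters_subset_clusters [Fintype V] (s : State V) (v : V) :
    s.adjClusters v ⊆ s.clusters := fun c hc => by
  obtain ⟨u, hu⟩ := (s.mem_adjClusters v c).1 hc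
  exact (s.mem_clusters c).2 ⟨u, hu.2⟩

theorem joinTarget_mem [Fintype V] [LinearOrder V] {s : State V} {R : Finset V} {v c : V}
    (h : s.joinTarget R v = some c) : c ∈ s.adjClusters v ∧ c ∈ R := by
  unfold joinTarget at h
  split_ifs at h with hne
  obtain rfl := Option.some.inj h
  exact Finset.mem_inter.1 (Finset.min'_mem _ hne)

/-! ### Expectations and outcomes along the iterations -/

/-- The state after one iteration in which the clusters `R` have been sampled. -/
def step [Fintype V] [LinearOrder V] (s : State V) (R : Finset V) : State V :=
  (s.grow R).removeInternal

theorem expect_iteration [Fintype V] [LinearOrder V] (p : ℝ≥0∞) (hp : p ≤ 1) (s : State V)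
    (f : State V → ℝ≥0∞) :
    expect (iteration p hp s) (fun y => f y.1) =
      expect (randomSubset s.clusters p hp) fun R => f (s.step R) := by
  have h : ∀ R, expect (andThen (oneRound (PMF.pure (s.grow R))) fun s' =>
      oneRound (PMF.pure s'.removeInternal)) (fun y => f y.1) = f (s.step R) := by
    intro R
    rw [expect_andThen, oneRound, PMF.pure_map, expect_pure, expect_oneRound, expect_pure]
    rfl
  rw [iteration, expect_andThen,
    expect_oneRound _ (fun R => expect (andThen (oneRound (PMF.pure (s.grow R))) fun s' =>
      oneRound (PMF.pure s'.removeInternal)) (fun y => f y.1))]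
  simp only [h]

/-- That `R` consists of clusters is deliberately forgotten: the stretch and round bounds hold for
any set `R`. -/
theorem mem_support_iteration [Fintype V] [LinearOrder V] {p : ℝ≥0∞} {hp : p ≤ 1} {s : State V}
    {y : State V × ℕ} (hy : y ∈ (iteration p hp s).support) : ∃ R, y = (s.step R, 3) := by
  simp only [iteration, mem_support_andThen, mem_support_oneRound_pure] at hy
  obtain ⟨x, hx, _, ⟨_, rfl, _, rfl, rfl⟩, rfl⟩ := hy
  obtain ⟨R, -, rfl⟩ := (PMF.mem_support_map_iff _ _ _).1 hx
  exact ⟨R, rfl⟩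

/-- Induction along the outcomes of successive iterations. -/
theorem iterations_induction [Fintype V] [LinearOrder V] {p : ℝ≥0∞} {hp : p ≤ 1}
    {Q : ℕ → State V → Prop} (hstep : ∀ i s R, Q i s → Q (i + 1) (s.step R)) (i j : ℕ)
    (s : State V) (hs : Q j s) :
    ∀ y ∈ (iterations p hp i s).support, Q (j + i) y.1 ∧ y.2 = 3 * i := by
  induction i generalizing j s with
  | zero =>
    intro y hy
    rw [iterations, PMF.mem_support_pure_iff] at hy
    subst hy
    exact ⟨hs, rfl⟩
  | succ i ih =>
    intro y hy
    rw [iterations, mem_support_andThen] at hy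
    obtain ⟨x, hx, z, hz, rfl⟩ := hy
    obtain ⟨R, rfl⟩ := mem_support_iteration hx
    obtain ⟨h1, h2⟩ := ih (j + 1) _ (hstep _ _ R hs) z hz
    exact ⟨by rwa [Nat.add_right_comm] at h1, by simp only [h2]; ring⟩

/-- A potential that one iteration multiplies by at most `a` in expectation. -/
theorem expect_iterations_le_pow_mul [Fintype V] [LinearOrder V] (p : ℝ≥0∞) (hp : p ≤ 1)
    (a : ℝ≥0∞) (f : State V → ℝ≥0∞)
    (h : ∀ s, expect (iteration p hp s) (fun y => f y.1) ≤ a * f s) (i : ℕ) (s : State V) :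
    expect (iterations p hp i s) (fun y => f y.1) ≤ a ^ i * f s := by
  induction i generalizing s with
  | zero => simp [iterations, expect_pure]
  | succ i ih =>
    rw [iterations, expect_andThen]
    calc _ ≤ expect (iteration p hp s) (fun x => a ^ i * f x.1) := expect_mono _ fun x => ih x.1
      _ = a ^ i * expect (iteration p hp s) (fun x => f x.1) := expect_const_mul _ _ _
      _ ≤ a ^ i * (a * f s) := by gcongr; exact h s
      _ = a ^ (i + 1) * f s := by ring

/-- A potential that one iteration increases by at most `b` in expectation. -/
theorem expect_iterations_le_add_mul [Fintype V] [LinearOrder V] (p : ℝ≥0∞) (hp : p ≤ 1)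
    (b : ℝ≥0∞) (f : State V → ℝ≥0∞)
    (h : ∀ s, expect (iteration p hp s) (fun y => f y.1) ≤ f s + b) (i : ℕ) (s : State V) :
    expect (iterations p hp i s) (fun y => f y.1) ≤ f s + i * b := by
  induction i generalizing s with
  | zero => simp [iterations, expect_pure]
  | succ i ih =>
    rw [iterations, expect_andThen]
    calc _ ≤ expect (iteration p hp s) (fun x => f x.1 + i * b) := expect_mono _ fun x => ih x.1
      _ = expect (iteration p hp s) (fun x => f x.1) + i * b := by
        rw [expect_add, expect_const]
      _ ≤ f s + b + i * b := by gcongr; exact h s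
      _ = f s + (i + 1 : ℕ) * b := by push_cast; ring

/-! ### Moments of the number of clusters -/

theorem clusters_step_subset [Fintype V] [LinearOrder V] (s : State V) (R : Finset V) :
    (s.step R).clusters ⊆ R := by
  intro c hc
  obtain ⟨v, hv⟩ := (mem_clusters _ _).1 hc
  simp only [step, removeInternal, grow] at hv
  split_ifs at hv with h
  · obtain ⟨d, hd, hvd⟩ := h
    rw [hvd] at hv
    exact Option.some.inj hv ▸ hd
  · exact (joinTarget_mem hv).2

theorem expect_card_clusters_iterations [Fintype V] [LinearOrder V] (p : ℝ≥0∞) (hp : p ≤ 1)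
    (i : ℕ) (s : State V) :
    expect (iterations p hp i s) (fun y => (y.1.clusters.card : ℝ≥0∞)) ≤
      p ^ i * s.clusters.card := by
  refine expect_iterations_le_pow_mul p hp p (fun s => (s.clusters.card : ℝ≥0∞)) (fun s => ?_) i s
  rw [expect_iteration p hp s fun s => (s.clusters.card : ℝ≥0∞),
    ← expect_card_randomSubset s.clusters p hp]
  exact expect_mono _ fun R => Nat.cast_le.2 (Finset.card_le_card (clusters_step_subset s R))

/-- The factorial moment replaces the plain second moment because sampling multiplies it by exactly
`p ^ 2`, so iterating produces no lower-order terms. -/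
theorem expect_card_clusters_mul_pred_iterations [Fintype V] [LinearOrder V] (p : ℝ≥0∞)
    (hp : p ≤ 1) (i : ℕ) (s : State V) :
    expect (iterations p hp i s)
        (fun y => ((y.1.clusters.card * (y.1.clusters.card - 1) : ℕ) : ℝ≥0∞)) ≤
      (p ^ 2) ^ i * ((s.clusters.card * (s.clusters.card - 1) : ℕ) : ℝ≥0∞) := by
  refine expect_iterations_le_pow_mul p hp (p ^ 2)
    (fun s => ((s.clusters.card * (s.clusters.card - 1) : ℕ) : ℝ≥0∞)) (fun s => ?_) i s
  rw [expect_iteration p hp s fun s => ((s.clusters.card * (s.clusters.card - 1) : ℕ) : ℝ≥0∞),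
    ← expect_card_mul_pred_randomSubset s.clusters p hp]
  refine expect_mono _ fun R => Nat.cast_le.2 ?_
  have h := Finset.card_le_card (clusters_step_subset s R)
  exact Nat.mul_le_mul h (Nat.sub_le_sub_right h 1)

theorem clusters_init [Fintype V] (G : SimpleGraph V) : (init G).clusters = Finset.univ := by
  ext c
  simp [mem_clusters, init]

/-! ### Numbers of edges -/

theorem ncard_edgeSet_sup_le [Finite V] (G H : SimpleGraph V) :
    (G ⊔ H).edgeSet.ncard ≤ G.edgeSet.ncard + H.edgeSet.ncard := by
  rw [SimpleGraph.edgeSet_sup]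
  exact Set.ncard_union_le _ _

theorem ncard_edgeSet_oneEdgeEach_le [Fintype V] [LinearOrder V] (s : State V)
    (A : V → Finset V) : (s.oneEdgeEach A).edgeSet.ncard ≤ ∑ v, (A v).card := by
  classical
  -- Every edge is the value of `g` at a pair of a vertex and a cluster; the loop is a dummy value
  -- for pairs without an edge.
  let g : (Σ _ : V, V) → Sym2 V := fun x =>
    if h : ∃ u, IsLeast (s.edgesTo x.1 x.2) u then s(x.1, h.choose) else s(x.1, x.1)
  have hg : ∀ v u c, c ∈ A v → IsLeast (s.edgesTo v c) u →
      s(v, u) ∈ (Finset.univ.sigma A).image g := by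
    intro v u c hc hu
    refine Finset.mem_image.2 ⟨⟨v, c⟩, by simp [hc], ?_⟩
    have h : ∃ u, IsLeast (s.edgesTo v c) u := ⟨u, hu⟩
    simp only [g, dif_pos h]
    rw [h.choose_spec.unique hu]
  have hsub : (s.oneEdgeEach A).edgeSet ⊆ ((Finset.univ.sigma A).image g : Finset (Sym2 V)) := by
    intro e
    induction e with | _ v u
    intro he
    rw [SimpleGraph.mem_edgeSet, oneEdgeEach, SimpleGraph.fromRel_adj] at he
    obtain ⟨-, ⟨c, hc, hu⟩ | ⟨c, hc, hu⟩⟩ := he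
    · exact hg v u c hc hu
    · rw [Sym2.eq_swap]
      exact hg u v c hc hu
  calc _ ≤ ((Finset.univ.sigma A).image g).card := by
        rw [← Set.ncard_coe_finset]
        exact Set.ncard_le_ncard hsub (Finset.finite_toSet _)
    _ ≤ _ := Finset.card_image_le
    _ = _ := Finset.card_sigma _ _

/-- A vertex outside the sampled clusters fails to join one exactly when `R` misses all its adjacent
clusters; otherwise it settles at most one. -/
theorem card_settled_le [Fintype V] [LinearOrder V] (s : State V) (R : Finset V) (v : V) :
    (s.settled R v).card ≤
      1 + (s.adjClusters v).card * if Disjoint (s.adjClusters v) R then 1 else 0 := by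
  unfold settled
  split_ifs with h hd hd
  · simp
  · simp
  · cases s.joinTarget R v <;> simp
  · have : s.joinTarget R v ≠ none := by
      rw [Finset.disjoint_iff_inter_eq_empty, ← Finset.not_nonempty_iff_eq_empty, not_not] at hd
      simp [joinTarget, hd]
    cases hj : s.joinTarget R v with
    | none => exact absurd hj this
    | some c => simp

theorem expect_size_iteration [Fintype V] [LinearOrder V] (p : ℝ≥0∞) (hp : p ≤ 1)
    (s : State V) :
    expect (iteration p hp s) (fun y => (y.1.spanner.edgeSet.ncard : ℝ≥0∞)) ≤
      s.spanner.edgeSet.ncard + Fintype.card V * (1 + p⁻¹) := by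
  rw [expect_iteration p hp s fun s => (s.spanner.edgeSet.ncard : ℝ≥0∞)]
  have h : ∀ R, ((s.step R).spanner.edgeSet.ncard : ℝ≥0∞) ≤ s.spanner.edgeSet.ncard +
      ∑ v, (1 + ((s.adjClusters v).card : ℝ≥0∞) *
        if Disjoint (s.adjClusters v) R then 1 else 0) := by
    intro R
    have h1 : (s.step R).spanner.edgeSet.ncard ≤ s.spanner.edgeSet.ncard +
        ∑ v, (1 + (s.adjClusters v).card * if Disjoint (s.adjClusters v) R then 1 else 0) :=
      (ncard_edgeSet_sup_le _ _).trans (Nat.add_le_add_left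
        ((ncard_edgeSet_oneEdgeEach_le _ _).trans
          (Finset.sum_le_sum fun v _ => card_settled_le s R v)) _)
    exact_mod_cast h1
  refine (expect_mono _ h).trans ?_
  rw [expect_add, expect_const, expect_sum]
  gcongr
  refine (Finset.sum_le_card_nsmul _ _ (1 + p⁻¹) fun v _ => ?_).trans
    (by rw [Finset.card_univ, nsmul_eq_mul])
  rw [expect_add, expect_const, expect_const_mul,
    expect_disjoint_randomSubset _ _ _ (s.adjClusters_subset_clusters v)]
  gcongr
  exact nat_mul_one_sub_pow_le_inv hp _

theorem expect_size_iterations_init [Fintype V] [LinearOrder V] (p : ℝ≥0∞) (hp : p ≤ 1)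
    (i : ℕ) (G : SimpleGraph V) :
    expect (iterations p hp i (init G)) (fun y => (y.1.spanner.edgeSet.ncard : ℝ≥0∞)) ≤
      i * (Fintype.card V * (1 + p⁻¹)) := by
  have h := expect_iterations_le_add_mul p hp _
    (fun s : State V => (s.spanner.edgeSet.ncard : ℝ≥0∞)) (expect_size_iteration p hp) i (init G)
  simpa [init] using h

end State

theorem liftEdges_adj {V : Type u} [Fintype V] [LinearOrder V] {G : SimpleGraph V} {s : State V}
    {H : SimpleGraph {c : V // c ∈ s.clusters}} {v u : V} (h : (liftEdges G s H).Adj v u) :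
    ∃ c d, H.Adj c d ∧ s.clusterOf v = some c.1 ∧ s.clusterOf u = some d.1 ∧ G.Adj v u := by
  rw [liftEdges, SimpleGraph.fromRel_adj] at h
  obtain ⟨-, ⟨c, d, hcd, -, hv, hu⟩ | ⟨c, d, hcd, -, hv, hu⟩⟩ := h
  · exact ⟨c, d, hcd, hv.1.1, hu.1.2, hu.1.1⟩
  · exact ⟨d, c, hcd.symm, hu.1.2, hv.1.1, hu.1.1.symm⟩

/-- Sending an edge to the pair of clusters of its ends maps the lifted edges injectively into the
edges of `H`: the pair, ordered by `c < d`, determines both least endpoints. -/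
theorem ncard_edgeSet_liftEdges_le {V : Type u} [Fintype V] [LinearOrder V] (G : SimpleGraph V)
    (s : State V) (H : SimpleGraph {c : V // c ∈ s.clusters}) :
    (liftEdges G s H).edgeSet.ncard ≤ H.edgeSet.ncard := by
  let j : {c : V // c ∈ s.clusters} → Option V := fun c => some c.1
  have hmaps : ∀ e ∈ (liftEdges G s H).edgeSet,
      Sym2.map s.clusterOf e ∈ Sym2.map j '' H.edgeSet := by
    intro e
    induction e with | _ v u
    intro he
    obtain ⟨c, d, hcd, hv, hu, -⟩ := liftEdges_adj he
    exact ⟨s(c, d), hcd, by simp [j, hv, hu]⟩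
  have horient : ∀ e ∈ (liftEdges G s H).edgeSet, ∃ v u, e = s(v, u) ∧
      ∃ c d : {c : V // c ∈ s.clusters}, c < d ∧
    IsLeast {v' | s.clusterOf v' = some c.1 ∧ ∃ u', G.Adj v' u' ∧ s.clusterOf u' = some d.1} v ∧
    IsLeast {u' | G.Adj v u' ∧ s.clusterOf u' = some d.1} u := by
    intro e
    induction e with | _ v u
    intro he
    rw [SimpleGraph.mem_edgeSet, liftEdges, SimpleGraph.fromRel_adj] at he
    obtain ⟨-, ⟨c, d, -, h⟩ | ⟨c, d, -, h⟩⟩ := he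
    · exact ⟨v, u, rfl, c, d, h⟩
    · exact ⟨u, v, Sym2.eq_swap, c, d, h⟩
  have hinj : Set.InjOn (Sym2.map s.clusterOf) (liftEdges G s H).edgeSet := by
    intro e he e' he' hee
    obtain ⟨v, u, rfl, c, d, hcd, hv, hu⟩ := horient e he
    obtain ⟨v', u', rfl, c', d', hcd', hv', hu'⟩ := horient e' he'
    have h : s(c, d) = s(c', d') := by
      have := hee
      simp only [Sym2.map_mk, hv.1.1, hu.1.2, hv'.1.1, hu'.1.2, Sym2.eq_iff, Option.some.injEq,
        Subtype.coe_inj] at this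
      exact Sym2.eq_iff.2 this
    obtain ⟨rfl, rfl⟩ | ⟨rfl, rfl⟩ := Sym2.eq_iff.1 h
    · obtain rfl := hv.unique hv'
      rw [hu.unique hu']
    · exact absurd hcd (not_lt.2 hcd'.le)
  calc _ ≤ (Sym2.map j '' H.edgeSet).ncard :=
        Set.ncard_le_ncard_of_injOn _ hmaps hinj (Set.toFinite _)
    _ ≤ _ := Set.ncard_image_le (Set.toFinite _)

/-! ### Stretch -/

theorem exists_isLeast_of_finite {V : Type u} [Finite V] [LinearOrder V] {S : Set V}
    (hS : S.Nonempty) : ∃ a, IsLeast S a := by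
  obtain ⟨a, ha, h⟩ := Set.exists_min_image S id (Set.toFinite S) hS
  exact ⟨a, ha, h⟩

/-- Used with `f = id` to pass from edges to paths, and with `f = Subtype.val` to turn a path of
clusters into a path between their centres. -/
theorem edist_le_mul_length {V W : Type u} {G : SimpleGraph V} {H : SimpleGraph W} (f : V → W)
    {m : ℕ} (h : ∀ u v, G.Adj u v → H.edist (f u) (f v) ≤ m) {u v : V} (w : G.Walk u v) :
    H.edist (f u) (f v) ≤ (w.length * m : ℕ) := by
  induction w with
  | nil => simp
  | cons hadj w ih =>
    refine SimpleGraph.edist_triangle.trans ((add_le_add (h _ _ hadj) ih).trans ?_)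
    rw [SimpleGraph.Walk.length_cons]
    push_cast
    rw [add_mul, one_mul, add_comm]

/-- It suffices to bound the stretch of the edges. -/
theorem isSpanner_of_edist_le {V : Type u} {G H : SimpleGraph V} (hle : H ≤ G) {m : ℕ}
    (h : ∀ u v, G.Adj u v → H.edist u v ≤ m) {σ : ℝ} (hσ : (m : ℝ) ≤ σ) : IsSpanner G H σ := by
  refine ⟨hle, fun u v huv => ?_⟩
  obtain ⟨w, hw⟩ := huv.exists_walk_length_eq_dist
  have hd : H.edist u v ≤ (w.length * m : ℕ) := edist_le_mul_length id h w
  have hr : H.Reachable u v :=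
    SimpleGraph.reachable_of_edist_ne_top (ne_top_of_le_ne_top (ENat.natCast_ne_top _) hd)
  refine ⟨hr, ?_⟩
  rw [← hr.coe_dist_eq_edist, Nat.cast_le, hw] at hd
  calc (H.dist u v : ℝ) ≤ (G.dist u v * m : ℕ) := Nat.cast_le.2 hd
    _ = m * G.dist u v := by push_cast; ring
    _ ≤ σ * G.dist u v := by gcongr

/-! ### The radius invariant -/

namespace State

variable {V : Type u}

/-- The invariant of the clustering process: every cluster has radius at most `r` in the spanner,
the ends of unprocessed edges are clustered, and the other edges have stretch at most `2 * r`. -/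
structure HasRadius (G : SimpleGraph V) (r : ℕ) (s : State V) : Prop where
  spanner_le : s.spanner ≤ G
  unprocessed_le : s.unprocessed ≤ G
  edist_center : ∀ v c, s.clusterOf v = some c → s.spanner.edist v c ≤ r
  clustered : ∀ v u, s.unprocessed.Adj v u → ∃ c, s.clusterOf v = some c
  edist_processed : ∀ v u, G.Adj v u → ¬ s.unprocessed.Adj v u →
    s.spanner.edist v u ≤ (2 * r : ℕ)

theorem hasRadius_init (G : SimpleGraph V) : HasRadius G 0 (init G) where
  spanner_le := bot_le
  unprocessed_le := le_rfl
  edist_center v c h := by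
    obtain rfl : v = c := Option.some.inj h
    simp
  clustered v u _ := ⟨v, rfl⟩
  edist_processed v u h h' := absurd h h'

theorem oneEdgeEach_le [LinearOrder V] (s : State V) (A : V → Finset V) :
    s.oneEdgeEach A ≤ s.unprocessed := by
  intro v u h
  rw [oneEdgeEach, SimpleGraph.fromRel_adj] at h
  obtain ⟨-, ⟨c, -, hu⟩ | ⟨c, -, hu⟩⟩ := h
  · exact hu.1.1
  · exact hu.1.1.symm

namespace HasRadius

variable {G : SimpleGraph V} {r : ℕ} {s : State V}

theorem edist_le_of_clusterOf_eq (h : HasRadius G r s) {v u c : V} (hv : s.clusterOf v = some c)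
    (hu : s.clusterOf u = some c) : s.spanner.edist v u ≤ (2 * r : ℕ) := by
  refine SimpleGraph.edist_triangle.trans ((add_le_add (h.edist_center v c hv)
    (SimpleGraph.edist_comm.trans_le (h.edist_center u c hu))).trans ?_)
  norm_cast
  omega

variable [Fintype V] [LinearOrder V]

theorem edist_center_le_of_mem (h : HasRadius G r s) {A : V → Finset V} {v c : V} (hc : c ∈ A v)
    (hne : (s.edgesTo v c).Nonempty) :
    (s.spanner ⊔ s.oneEdgeEach A).edist v c ≤ (r + 1 : ℕ) := by
  obtain ⟨u, hu⟩ := exists_isLeast_of_finite hne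
  have hadj : (s.spanner ⊔ s.oneEdgeEach A).Adj v u := by
    refine Or.inr ?_
    rw [oneEdgeEach, SimpleGraph.fromRel_adj]
    exact ⟨hu.1.1.ne, Or.inl ⟨c, hc, hu⟩⟩
  refine SimpleGraph.edist_triangle.trans ((add_le_add
    (SimpleGraph.edist_eq_one_iff_adj.2 hadj).le ((SimpleGraph.edist_anti le_sup_left).trans
      (h.edist_center u c hu.1.2))).trans ?_)
  norm_cast
  omega

theorem edist_le_of_mem (h : HasRadius G r s) {A : V → Finset V} {v u c : V} (hc : c ∈ A v)
    (hu : u ∈ s.edgesTo v c) :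
    (s.spanner ⊔ s.oneEdgeEach A).edist v u ≤ (2 * r + 1 : ℕ) := by
  refine SimpleGraph.edist_triangle.trans ((add_le_add (h.edist_center_le_of_mem hc ⟨u, hu⟩)
    (SimpleGraph.edist_comm.trans_le ((SimpleGraph.edist_anti le_sup_left).trans
      (h.edist_center u c hu.2)))).trans ?_)
  norm_cast
  omega

theorem grow_edist_center (h : HasRadius G r s) (R : Finset V) (v c : V)
    (hv : (s.grow R).clusterOf v = some c) :
    (s.grow R).spanner.edist v c ≤ (r + 1 : ℕ) := by
  simp only [grow] at hv ⊢
  split_ifs at hv with hR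
  · refine (SimpleGraph.edist_anti le_sup_left).trans ((h.edist_center v c hv).trans ?_)
    norm_cast
    omega
  · refine h.edist_center_le_of_mem ?_ ((s.mem_adjClusters v c).1 (joinTarget_mem hv).1)
    simp [settled, hR, hv]

theorem step (h : HasRadius G r s) (R : Finset V) : HasRadius G (r + 1) (s.step R) where
  spanner_le := sup_le h.spanner_le ((s.oneEdgeEach_le _).trans h.unprocessed_le)
  unprocessed_le := (sdiff_le.trans sdiff_le).trans h.unprocessed_le
  edist_center := h.grow_edist_center R
  clustered v u huv := by
    simp only [State.step, removeInternal, grow, SimpleGraph.sdiff_adj] at huv ⊢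
    obtain ⟨⟨huv, hset⟩, -⟩ := huv
    split_ifs with hR
    · exact h.clustered v u huv
    · cases hj : s.joinTarget R v with
      | some c => exact ⟨c, rfl⟩
      | none =>
        -- A vertex leaving the clustering keeps no unprocessed edge: the other end lies in some
        -- cluster, and all edges to adjacent clusters are settled.
        obtain ⟨c, hc⟩ := h.clustered u v huv.symm
        have hu : u ∈ s.edgesTo v c := ⟨huv, hc⟩
        refine absurd ?_ hset
        rw [SimpleGraph.fromRel_adj]
        refine ⟨huv.ne, Or.inl ⟨c, ?_, hu⟩⟩
        simp only [settled, hR, hj, if_false]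
        exact (s.mem_adjClusters v c).2 ⟨u, hu⟩
  edist_processed v u hG huv := by
    -- An edge is processed because it was so before (`2 * r`), because one end settled the other's
    -- cluster (`(r + 1) + r`), or because it lies inside a new cluster (`2 * (r + 1)`).
    by_cases hs : s.unprocessed.Adj v u
    · by_cases hset : (SimpleGraph.fromRel fun v u =>
          ∃ c ∈ s.settled R v, u ∈ s.edgesTo v c).Adj v u
      · have key : (s.step R).spanner.edist v u ≤ (2 * r + 1 : ℕ) := by
          obtain ⟨-, ⟨c, hc, hu⟩ | ⟨c, hc, hu⟩⟩ := (SimpleGraph.fromRel_adj _ _ _).1 hset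
          · exact h.edist_le_of_mem hc hu
          · exact SimpleGraph.edist_comm.trans_le (h.edist_le_of_mem hc hu)
        refine key.trans ?_
        norm_cast
        omega
      · have hint : (SimpleGraph.fromRel fun v u => ∃ c, (s.grow R).clusterOf v = some c ∧
            (s.grow R).clusterOf u = some c).Adj v u := by
          by_contra hint
          exact huv ⟨⟨hs, hset⟩, hint⟩
        have key : ∀ a b c, (s.grow R).clusterOf a = some c → (s.grow R).clusterOf b = some c →
            (s.step R).spanner.edist a b ≤ (2 * (r + 1) : ℕ) := by
          intro a b c ha hb
          refine SimpleGraph.edist_triangle.trans ((add_le_add (h.grow_edist_center R a c ha)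
            (SimpleGraph.edist_comm.trans_le (h.grow_edist_center R b c hb))).trans ?_)
          norm_cast
          omega
        obtain ⟨-, ⟨c, hv, hu⟩ | ⟨c, hu, hv⟩⟩ := (SimpleGraph.fromRel_adj _ _ _).1 hint
        · exact key v u c hv hu
        · exact key v u c hv hu
    · refine (SimpleGraph.edist_anti le_sup_left).trans
        ((h.edist_processed v u hG hs).trans ?_)
      norm_cast
      omega

/-- The spanner that the Baswana-Sen algorithm obtains from a clustering of radius `r`. -/
theorem isSpanner_last (h : HasRadius G r s) :
    IsSpanner G (s.spanner ⊔ s.oneEdgeEach s.adjClusters) (2 * r + 1 : ℕ) := by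
  refine isSpanner_of_edist_le (sup_le h.spanner_le ((s.oneEdgeEach_le _).trans h.unprocessed_le))
    (fun v u hG => ?_) le_rfl
  by_cases hs : s.unprocessed.Adj v u
  · obtain ⟨c, hc⟩ := h.clustered u v hs.symm
    exact h.edist_le_of_mem ((s.mem_adjClusters v c).2 ⟨u, hs, hc⟩) ⟨hs, hc⟩
  · refine (SimpleGraph.edist_anti le_sup_left).trans
      ((h.edist_processed v u hG hs).trans ?_)
    norm_cast
    omega

theorem edist_liftEdges (h : HasRadius G r s) {H : SimpleGraph {c : V // c ∈ s.clusters}}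
    (hH : H ≤ quotientGraph G s) (c d : {c : V // c ∈ s.clusters}) (hcd : H.Adj c d) :
    (s.spanner ⊔ liftEdges G s H).edist c.1 d.1 ≤ (2 * r + 1 : ℕ) := by
  have key : ∀ c d, H.Adj c d → c < d →
      (s.spanner ⊔ liftEdges G s H).edist c.1 d.1 ≤ (2 * r + 1 : ℕ) := by
    intro c d hcd hlt
    have hne : {v' | s.clusterOf v' = some c.1 ∧
        ∃ u', G.Adj v' u' ∧ s.clusterOf u' = some d.1}.Nonempty := by
      have hQ := hH hcd
      rw [quotientGraph, SimpleGraph.fromRel_adj] at hQ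
      obtain ⟨-, ⟨v, u, hG, hv, hu⟩ | ⟨v, u, hG, hv, hu⟩⟩ := hQ
      · exact ⟨v, hv, u, hG, hu⟩
      · exact ⟨u, hu, v, hG.symm, hv⟩
    obtain ⟨v, hv⟩ := exists_isLeast_of_finite hne
    obtain ⟨u, hu⟩ := exists_isLeast_of_finite
      (S := {u' | G.Adj v u' ∧ s.clusterOf u' = some d.1}) hv.1.2
    have hadj : (s.spanner ⊔ liftEdges G s H).Adj v u := by
      refine Or.inr ?_
      rw [liftEdges, SimpleGraph.fromRel_adj]
      exact ⟨hu.1.1.ne, Or.inl ⟨c, d, hcd, hlt, hv, hu⟩⟩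
    have h1 : (s.spanner ⊔ liftEdges G s H).edist c.1 v ≤ r :=
      SimpleGraph.edist_comm.trans_le
        ((SimpleGraph.edist_anti le_sup_left).trans (h.edist_center v _ hv.1.1))
    have h2 : (s.spanner ⊔ liftEdges G s H).edist u d.1 ≤ r :=
      (SimpleGraph.edist_anti le_sup_left).trans (h.edist_center u _ hu.1.2)
    refine SimpleGraph.edist_triangle.trans ((add_le_add h1 (SimpleGraph.edist_triangle.trans
      (add_le_add (SimpleGraph.edist_eq_one_iff_adj.2 hadj).le h2))).trans ?_)
    norm_cast
    omega
  obtain hlt | hlt := lt_or_gt_of_ne hcd.ne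
  · exact key c d hcd hlt
  · exact SimpleGraph.edist_comm.trans_le (key d c hcd.symm hlt)

/-- A spanner of the quotient graph of a clustering of radius `r` yields a spanner of `G`. -/
theorem isSpanner_contraction (h : HasRadius G r s) {H : SimpleGraph {c : V // c ∈ s.clusters}}
    {m : ℕ} (hH : IsSpanner (quotientGraph G s) H m) :
    IsSpanner G (s.spanner ⊔ liftEdges G s H) (2 * r + m * (2 * r + 1) : ℕ) := by
  have hlift : liftEdges G s H ≤ G := fun v u hvu => by
    obtain ⟨c, d, -, -, -, hG⟩ := liftEdges_adj hvu
    exact hG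
  refine isSpanner_of_edist_le (sup_le h.spanner_le hlift) (fun v u hG => ?_) le_rfl
  have hshort : s.spanner.edist v u ≤ (2 * r : ℕ) →
      (s.spanner ⊔ liftEdges G s H).edist v u ≤ (2 * r + m * (2 * r + 1) : ℕ) := fun hs =>
    (SimpleGraph.edist_anti le_sup_left).trans
      (hs.trans (Nat.cast_le.2 (Nat.le_add_right _ _)))
  by_cases hs : s.unprocessed.Adj v u
  · obtain ⟨c, hc⟩ := h.clustered v u hs
    obtain ⟨d, hd⟩ := h.clustered u v hs.symm
    -- The invariant does not exclude unprocessed edges inside a cluster; these are short because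
    -- the cluster has radius `r`.
    by_cases hcd : c = d
    · exact hshort (h.edist_le_of_clusterOf_eq (hcd ▸ hc) hd)
    · let c' : {c : V // c ∈ s.clusters} := ⟨c, (s.mem_clusters c).2 ⟨v, hc⟩⟩
      let d' : {c : V // c ∈ s.clusters} := ⟨d, (s.mem_clusters d).2 ⟨u, hd⟩⟩
      have hQ : (quotientGraph G s).Adj c' d' := by
        rw [quotientGraph, SimpleGraph.fromRel_adj]
        exact ⟨fun hne => hcd (congrArg Subtype.val hne), Or.inl ⟨v, u, hG, hc, hd⟩⟩
      obtain ⟨hreach, hdist⟩ := hH.2 c' d' hQ.reachable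
      rw [SimpleGraph.dist_eq_one_iff_adj.2 hQ, Nat.cast_one, mul_one, Nat.cast_le] at hdist
      obtain ⟨w, hw⟩ := hreach.exists_walk_length_eq_dist
      -- At most `m` quotient edges, each costing `2 * r + 1` between centres; reaching the two
      -- centres costs `r` at either end.
      have hpath : (s.spanner ⊔ liftEdges G s H).edist c d ≤ (m * (2 * r + 1) : ℕ) :=
        (edist_le_mul_length Subtype.val (h.edist_liftEdges hH.1) w).trans
          (Nat.cast_le.2 (Nat.mul_le_mul_right _ (hw ▸ hdist)))
      have h1 : (s.spanner ⊔ liftEdges G s H).edist v c ≤ r :=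
        (SimpleGraph.edist_anti le_sup_left).trans (h.edist_center v _ hc)
      have h2 : (s.spanner ⊔ liftEdges G s H).edist d u ≤ r :=
        SimpleGraph.edist_comm.trans_le
          ((SimpleGraph.edist_anti le_sup_left).trans (h.edist_center u _ hd))
      refine SimpleGraph.edist_triangle.trans ((add_le_add h1 (SimpleGraph.edist_triangle.trans
        (add_le_add hpath h2))).trans (le_of_eq ?_))
      push_cast
      ring
  · exact hshort (h.edist_processed v u hG hs)

end HasRadius

theorem hasRadius_iterations [Fintype V] [LinearOrder V] {p : ℝ≥0∞} {hp : p ≤ 1} {i : ℕ}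
    {G : SimpleGraph V} {y : State V × ℕ} (hy : y ∈ (iterations p hp i (init G)).support) :
    HasRadius G i y.1 ∧ y.2 = 3 * i := by
  have h := iterations_induction (Q := HasRadius G) (fun i s R h => h.step R) i 0 (init G)
    (hasRadius_init G) y hy
  rwa [zero_add] at h

end State

/-! ### Sizes in terms of the number of vertices -/

theorem nat_mul_one_add_inv_sampleProb_le (n k : ℕ) :
    (n : ℝ≥0∞) * (1 + (sampleProb n k)⁻¹) ≤ ENNReal.ofReal (2 * (n : ℝ) ^ (1 + 1 / (k : ℝ))) := by
  -- For `n = 0` the inverse may be `⊤`, but `0 * ⊤ = 0`.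
  rcases Nat.eq_zero_or_pos n with rfl | hn
  · simp
  have hn' : (1 : ℝ) ≤ n := by exact_mod_cast hn
  have hpos : (0 : ℝ) < n := by linarith
  have hk : (0 : ℝ) ≤ 1 / (k : ℝ) := by positivity
  rw [sampleProb, ← ENNReal.ofReal_inv_of_pos (Real.rpow_pos_of_pos hpos _), ← Real.rpow_neg hpos.le,
    neg_neg, ← ENNReal.ofReal_natCast, ← ENNReal.ofReal_one,
    ← ENNReal.ofReal_add zero_le_one (Real.rpow_nonneg hpos.le _),
    ← ENNReal.ofReal_mul hpos.le, Real.rpow_add hpos, Real.rpow_one]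
  refine ENNReal.ofReal_le_ofReal ?_
  have := Real.one_le_rpow hn' hk
  nlinarith

theorem sampleProb_pow_mul {n : ℕ} (hn : 1 ≤ n) (k i : ℕ) :
    sampleProb n k ^ i * n = ENNReal.ofReal ((n : ℝ) ^ (1 - (i : ℝ) / (k : ℝ))) := by
  have hpos : (0 : ℝ) < n := by exact_mod_cast hn
  rw [sampleProb, ← ENNReal.ofReal_pow (Real.rpow_nonneg hpos.le _), ← Real.rpow_natCast,
    ← Real.rpow_mul hpos.le, ← ENNReal.ofReal_natCast,
    ← ENNReal.ofReal_mul (Real.rpow_nonneg hpos.le _), ← Real.rpow_add_one hpos.ne']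
  congr 2
  ring

/-! ### The guarantee of the Baswana-Sen algorithm -/

theorem baswanaSen_hasGuarantee {r : ℕ} (hr : 1 ≤ r) :
    (baswanaSen.{u} r).HasGuarantee 3 r := by
  intro W _ _ H
  have hr' : (1 : ℝ) ≤ r := by exact_mod_cast hr
  refine ⟨fun x hx => ?_, ?_⟩
  · simp only [baswanaSen, mem_support_andThen, mem_support_oneRound_pure] at hx
    obtain ⟨y, hy, _, rfl, rfl⟩ := hx
    obtain ⟨hrad, hrounds⟩ := State.hasRadius_iterations hy
    constructor
    · have h := hrad.isSpanner_last
      have hcast : ((2 * (r - 1) + 1 : ℕ) : ℝ) = 2 * (r : ℝ) - 1 := by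
        push_cast [Nat.cast_sub hr]
        ring
      rwa [hcast] at h
    -- The `3 * (r - 1) + 1` rounds dictate the constant `3`; the size needs only `2 * (r - 1) + 1`.
    · simp only [hrounds]
      push_cast [Nat.cast_sub hr]
      linarith
  · have hsize : ∀ s : State W, ((s.spanner ⊔ s.oneEdgeEach s.adjClusters).edgeSet.ncard : ℝ≥0∞) ≤
        s.spanner.edgeSet.ncard + Fintype.card W * s.clusters.card := by
      intro s
      have h : (s.spanner ⊔ s.oneEdgeEach s.adjClusters).edgeSet.ncard ≤
          s.spanner.edgeSet.ncard + Fintype.card W * s.clusters.card := by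
        refine (State.ncard_edgeSet_sup_le _ _).trans (Nat.add_le_add_left
          ((State.ncard_edgeSet_oneEdgeEach_le _ _).trans ?_) _)
        refine (Finset.sum_le_card_nsmul _ _ s.clusters.card fun v _ =>
          Finset.card_le_card (s.adjClusters_subset_clusters v)).trans ?_
        rw [Finset.card_univ, smul_eq_mul]
      exact_mod_cast h
    -- The last round costs at most one edge per pair of a vertex and a cluster; the exponents add
    -- up to `1 + (1 - (r - 1) / r) = 1 + 1 / r`.
    have hlast : (Fintype.card W : ℝ≥0∞) *
        (sampleProb (Fintype.card W) r ^ (r - 1) * Fintype.card W) ≤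
          ENNReal.ofReal ((Fintype.card W : ℝ) ^ (1 + 1 / (r : ℝ))) := by
      rcases Nat.eq_zero_or_pos (Fintype.card W) with h0 | hn
      · simp [h0]
      have hpos : (0 : ℝ) < Fintype.card W := by exact_mod_cast hn
      rw [sampleProb_pow_mul hn, ← ENNReal.ofReal_natCast, ← ENNReal.ofReal_mul hpos.le,
        mul_comm, ← Real.rpow_add_one hpos.ne']
      refine le_of_eq (congrArg _ (congrArg _ ?_))
      have : (r : ℝ) ≠ 0 := by positivity
      push_cast [Nat.cast_sub hr]
      field_simp
      ring
    calc expectedSize (baswanaSen r W H)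
        ≤ expect (State.iterations (sampleProb (Fintype.card W) r) (sampleProb_le_one _ _) (r - 1)
            (State.init H)) (fun y => (y.1.spanner.edgeSet.ncard : ℝ≥0∞) +
              Fintype.card W * (y.1.clusters.card : ℝ≥0∞)) := by
          refine (expect_andThen _ _ fun K : SimpleGraph W => (K.edgeSet.ncard : ℝ≥0∞)).trans_le
            (expect_mono _ fun y => ?_)
          rw [expect_oneRound _ fun K : SimpleGraph W => (K.edgeSet.ncard : ℝ≥0∞), expect_pure]
          exact hsize y.1
      _ ≤ ((r - 1 : ℕ) : ℝ≥0∞) * ENNReal.ofReal (2 * (Fintype.card W : ℝ) ^ (1 + 1 / (r : ℝ))) +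
            ENNReal.ofReal ((Fintype.card W : ℝ) ^ (1 + 1 / (r : ℝ))) := by
          rw [expect_add, expect_const_mul]
          refine add_le_add ((State.expect_size_iterations_init _ _ _ _).trans ?_) ?_
          · gcongr
            exact nat_mul_one_add_inv_sampleProb_le _ _
          · refine le_trans ?_ hlast
            gcongr
            refine (State.expect_card_clusters_iterations _ _ _ _).trans_eq ?_
            rw [State.clusters_init, Finset.card_univ]
      _ ≤ _ := by
          have hX : (0 : ℝ) ≤ (Fintype.card W : ℝ) ^ (1 + 1 / (r : ℝ)) :=
            Real.rpow_nonneg (Nat.cast_nonneg _) _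
          rw [← ENNReal.ofReal_natCast, ← ENNReal.ofReal_mul (Nat.cast_nonneg _),
            ← ENNReal.ofReal_add (by positivity) hX]
          refine ENNReal.ofReal_le_ofReal ?_
          push_cast [Nat.cast_sub hr]
          nlinarith

/-! ### A fractional moment of the number of clusters -/

/-- An interpolation between the first two factorial moments. -/
theorem natCast_rpow_one_add_le (N : ℕ) {M θ : ℝ} (hM : 1 ≤ M) (h0 : 0 ≤ θ) (h1 : θ ≤ 1) :
    (N : ℝ) ^ (1 + θ) ≤ M ^ θ * N + M ^ θ / M * ((N * (N - 1) : ℕ) : ℝ) := by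
  have hMpos : 0 < M := by linarith
  have hMθ : 0 < M ^ θ := Real.rpow_pos_of_pos hMpos _
  rcases Nat.eq_zero_or_pos N with rfl | hN
  · rw [Nat.cast_zero, Real.zero_rpow (by linarith)]
    simp
  have hNpos : (0 : ℝ) < N := by exact_mod_cast hN
  rw [Real.rpow_add hNpos, Real.rpow_one]
  -- Below `M` the linear term suffices. Above `M`, `N ^ (1 + θ) ≤ M ^ (θ - 1) * N ^ 2`, and `N ^ 2
  -- = N * (N - 1) + N`, where `M ≥ 1` absorbs the extra `N` into the linear term.
  rcases le_total (N : ℝ) M with h | h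
  · have : (N : ℝ) ^ θ ≤ M ^ θ := Real.rpow_le_rpow hNpos.le h h0
    have h2 : 0 ≤ M ^ θ / M * ((N * (N - 1) : ℕ) : ℝ) := by positivity
    nlinarith
  · have h2 : (N : ℝ) ^ (θ - 1) ≤ M ^ (θ - 1) :=
      Real.rpow_le_rpow_of_nonpos hMpos h (by linarith)
    rw [Real.rpow_sub_one hNpos.ne', Real.rpow_sub_one hMpos.ne', div_le_iff₀ hNpos] at h2
    have h3 : M ^ θ / M ≤ M ^ θ := div_le_self hMθ.le hM
    push_cast [Nat.cast_sub hN]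
    nlinarith

theorem expect_card_clusters_rpow_le {V : Type u} [Fintype V] [LinearOrder V]
    (G : SimpleGraph V) {k t r : ℕ} (hk : 1 ≤ k) (hr : 1 ≤ r) (htr : k ≤ t * r) :
    expect (State.iterations (sampleProb (Fintype.card V) k) (sampleProb_le_one _ _) t
        (State.init G))
      (fun y => ENNReal.ofReal ((y.1.clusters.card : ℝ) ^ (1 + 1 / (r : ℝ)))) ≤
      ENNReal.ofReal (2 * Fintype.card V) := by
  have hr' : (1 : ℝ) ≤ r := by exact_mod_cast hr
  have hk' : (1 : ℝ) ≤ k := by exact_mod_cast hk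
  set n := Fintype.card V with hn_def
  set θ : ℝ := 1 / (r : ℝ) with hθ
  have hθ0 : 0 ≤ θ := by positivity
  have hθ1 : θ ≤ 1 := (div_le_one (by linarith)).2 hr'
  rcases Nat.eq_zero_or_pos n with h0 | hn
  · refine (expect_mono _ (g := fun _ => 0) fun y => ?_).trans ?_
    · have hcard : y.1.clusters.card = 0 := Nat.le_zero.1 (h0 ▸ Finset.card_le_univ _)
      rw [hcard, Nat.cast_zero, Real.zero_rpow (by linarith), ENNReal.ofReal_zero]
    · rw [expect_const]
      exact bot_le
  have hn1 : (1 : ℝ) ≤ n := by exact_mod_cast hn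
  have hpos : (0 : ℝ) < n := by linarith
  set x : ℝ := 1 - (t : ℝ) / k with hx
  set m : ℝ := (n : ℝ) ^ x with hm
  -- The threshold is `max m 1`: the natural choice `m` drops below `1` when `t > k`.
  set M : ℝ := (n : ℝ) ^ (max x 0) with hM
  have hm0 : 0 < m := Real.rpow_pos_of_pos hpos _
  have hM1 : 1 ≤ M := Real.one_le_rpow hn1 (le_max_right _ _)
  have hM0 : 0 < M := by linarith
  have hmM : m ≤ M := Real.rpow_le_rpow_of_exponent_le hn1 (le_max_left _ _)
  -- The only use of `k ≤ t * r`: it says `θ ≤ t / k`, so for `0 ≤ x ≤ 1` the exponent `x * θ + x`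
  -- is at most `θ + 1 - t / k ≤ 1`.
  have hMm : M ^ θ * m ≤ n := by
    rw [hM, hm, ← Real.rpow_mul hpos.le, ← Real.rpow_add hpos]
    refine (Real.rpow_le_rpow_of_exponent_le hn1 ?_).trans_eq (Real.rpow_one _)
    have htk : 0 ≤ (t : ℝ) / k := by positivity
    rcases le_total x 0 with h | h
    · rw [max_eq_right h]
      linarith
    · rw [max_eq_left h]
      have h1 : θ ≤ t / k := by
        rw [hθ, div_le_div_iff₀ (by linarith) (by linarith), one_mul]
        exact_mod_cast htr
      nlinarith
  have hmean : expect (State.iterations (sampleProb n k) (sampleProb_le_one _ _) t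
      (State.init G)) (fun y => (y.1.clusters.card : ℝ≥0∞)) ≤ ENNReal.ofReal m := by
    refine (State.expect_card_clusters_iterations _ _ _ _).trans_eq ?_
    rw [State.clusters_init, Finset.card_univ, ← hn_def, sampleProb_pow_mul hn]
  have hsecond : expect (State.iterations (sampleProb n k) (sampleProb_le_one _ _) t
      (State.init G)) (fun y => ((y.1.clusters.card * (y.1.clusters.card - 1) : ℕ) : ℝ≥0∞)) ≤
        ENNReal.ofReal (m ^ 2) := by
    refine (State.expect_card_clusters_mul_pred_iterations _ _ _ _).trans ?_
    rw [State.clusters_init, Finset.card_univ, ← hn_def, ENNReal.ofReal_pow hm0.le, hm, hx,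
      ← sampleProb_pow_mul hn, mul_pow, ← pow_mul, ← pow_mul, mul_comm 2 t, sq (n : ℝ≥0∞),
      ← Nat.cast_mul]
    gcongr
    exact Nat.sub_le _ _
  calc _ ≤ expect (State.iterations (sampleProb n k) (sampleProb_le_one _ _) t (State.init G))
        (fun y => ENNReal.ofReal (M ^ θ) * (y.1.clusters.card : ℝ≥0∞) +
          ENNReal.ofReal (M ^ θ / M) *
            ((y.1.clusters.card * (y.1.clusters.card - 1) : ℕ) : ℝ≥0∞)) := by
        refine expect_mono _ fun y => ?_
        refine (ENNReal.ofReal_le_ofReal (natCast_rpow_one_add_le _ hM1 hθ0 hθ1)).trans_eq ?_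
        rw [ENNReal.ofReal_add (by positivity) (by positivity), ENNReal.ofReal_mul (by positivity),
          ENNReal.ofReal_mul (by positivity), ENNReal.ofReal_natCast, ENNReal.ofReal_natCast]
    _ ≤ ENNReal.ofReal (M ^ θ) * ENNReal.ofReal m +
          ENNReal.ofReal (M ^ θ / M) * ENNReal.ofReal (m ^ 2) := by
        rw [expect_add, expect_const_mul, expect_const_mul]
        gcongr
    _ ≤ _ := by
        rw [← ENNReal.ofReal_mul (by positivity), ← ENNReal.ofReal_mul (by positivity),
          ← ENNReal.ofReal_add (by positivity) (by positivity)]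
        refine ENNReal.ofReal_le_ofReal ?_
        -- By `m ≤ M` the quadratic term is no larger than the linear one, whence the factor `2`.
        have h2 : M ^ θ / M * m ^ 2 ≤ M ^ θ * m := by
          rw [div_mul_eq_mul_div, div_le_iff₀ hM0, mul_assoc]
          have := Real.rpow_nonneg hM0.le θ
          gcongr
          nlinarith
        linarith

/-! ### The cluster-contraction algorithm -/

theorem expectedSize_clusterContraction_le {V : Type u} [Fintype V] [LinearOrder V]
    (G : SimpleGraph V) (k t : ℕ) (P : SpannerRoutine.{u}) :
    expectedSize (clusterContraction k t P G) ≤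
      expect (State.iterations (sampleProb (Fintype.card V) k) (sampleProb_le_one _ _) t
        (State.init G)) fun y => (y.1.spanner.edgeSet.ncard : ℝ≥0∞) +
          expectedSize (P {c : V // c ∈ y.1.clusters} (quotientGraph G y.1)) := by
  refine (expect_andThen _ _ fun K : SimpleGraph V => (K.edgeSet.ncard : ℝ≥0∞)).trans_le
    (expect_mono _ fun y => ?_)
  rw [expect_andThen _ _ fun K : SimpleGraph V => (K.edgeSet.ncard : ℝ≥0∞), oneRound,
    PMF.pure_map, expect_pure, expect_andThen _ _ fun K : SimpleGraph V => (K.edgeSet.ncard : ℝ≥0∞)]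
  refine (expect_mono _ (g := fun x => (y.1.spanner.edgeSet.ncard : ℝ≥0∞) +
    (x.1.edgeSet.ncard : ℝ≥0∞)) fun x => ?_).trans_eq ?_
  · rw [expect_oneRound _ fun K : SimpleGraph V => (K.edgeSet.ncard : ℝ≥0∞), expect_pure]
    have h : (y.1.spanner ⊔ liftEdges G y.1 x.1).edgeSet.ncard ≤
        y.1.spanner.edgeSet.ncard + x.1.edgeSet.ncard :=
      (State.ncard_edgeSet_sup_le _ _).trans
        (Nat.add_le_add_left (ncard_edgeSet_liftEdges_le _ _ _) _)
    exact_mod_cast h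
  · rw [expect_add, expect_const]
    rfl

theorem clusterContraction_computesSpanner {a B : ℝ} {k t r : ℕ} (hk : 1 ≤ k)
    (ht : √(k : ℝ) ≤ t) (hta : (t : ℝ) ≤ a * √(k : ℝ)) (hr : √(k : ℝ) ≤ r)
    (hra : (r : ℝ) ≤ a * √(k : ℝ)) {P : SpannerRoutine.{u}} (hP : P.HasGuarantee B r)
    {V : Type u} [Fintype V] [LinearOrder V] (G : SimpleGraph V) {C : ℝ}
    (hC1 : 8 * a ^ 2 ≤ C) (hC2 : 3 * a + 2 + |B| * a ≤ C) (hC3 : 2 * a + 2 * |B| * a ≤ C) :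
    ComputesSpanner G (clusterContraction k t P G) (C * (k : ℝ))
      (C * √(k : ℝ) * (Fintype.card V : ℝ) ^ (1 + 1 / (k : ℝ))) (C * √(k : ℝ)) := by
  have hk' : (1 : ℝ) ≤ k := by exact_mod_cast hk
  have hsq : √(k : ℝ) * √(k : ℝ) = k := Real.mul_self_sqrt (by linarith)
  have hs1 : 1 ≤ √(k : ℝ) := Real.one_le_sqrt.2 hk'
  have ht1 : (1 : ℝ) ≤ t := hs1.trans ht
  have has : 0 ≤ a * √(k : ℝ) := (Nat.cast_nonneg t).trans hta
  have hr1 : (1 : ℝ) ≤ r := hs1.trans hr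
  have hr1' : 1 ≤ r := by exact_mod_cast hr1
  have htr : k ≤ t * r := by
    have : (k : ℝ) ≤ t * r := by
      rw [← hsq]
      gcongr
    exact_mod_cast this
  have htr' : (t : ℝ) * r ≤ a ^ 2 * k := by
    calc (t : ℝ) * r ≤ (a * √(k : ℝ)) * (a * √(k : ℝ)) := by gcongr
      _ = a ^ 2 * (√(k : ℝ) * √(k : ℝ)) := by ring
      _ = a ^ 2 * k := by rw [hsq]
  have hB0 := abs_nonneg B
  have hBr : B * r ≤ |B| * (a * √(k : ℝ)) := by
    calc B * r ≤ |B| * r := by gcongr; exact le_abs_self B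
      _ ≤ _ := by gcongr
  refine ⟨fun x hx => ?_, ?_⟩
  · simp only [clusterContraction, mem_support_andThen, mem_support_oneRound_pure] at hx
    obtain ⟨y, hy, _, ⟨_, rfl, z, ⟨w, hw, _, rfl, rfl⟩, rfl⟩, rfl⟩ := hx
    obtain ⟨hrad, hrounds⟩ := State.hasRadius_iterations hy
    obtain ⟨hspan, hProunds⟩ := (hP _ (quotientGraph G y.1)).1 w hw
    constructor
    · have hcast : 2 * (r : ℝ) - 1 = ((2 * r - 1 : ℕ) : ℝ) := by
        rw [Nat.cast_sub (by omega)]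
        push_cast
        ring
      rw [hcast] at hspan
      obtain ⟨hle, h⟩ := hrad.isSpanner_contraction hspan
      refine ⟨hle, fun u v huv => ⟨(h u v huv).1, (h u v huv).2.trans ?_⟩⟩
      gcongr
      push_cast
      rw [← hcast]
      -- The stretch is `2 * t + (2 * r - 1) * (2 * t + 1) = 4 * t * r + 2 * r - 1 ≤ 6 * t * r`.
      nlinarith
    -- The contraction and the lifting of edges add two rounds to `3 * t + B * r`; `1 ≤ √k` absorbs
    -- them.
    · simp only [hrounds]
      push_cast
      nlinarith
  · have hn0 : (0 : ℝ) ≤ Fintype.card V := Nat.cast_nonneg _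
    have hn : (Fintype.card V : ℝ) ≤ (Fintype.card V : ℝ) ^ (1 + 1 / (k : ℝ)) := by
      rcases Nat.eq_zero_or_pos (Fintype.card V) with h0 | hpos
      · rw [h0, Nat.cast_zero]
        exact Real.rpow_nonneg le_rfl _
      · exact Real.self_le_rpow_of_one_le (by exact_mod_cast hpos)
          (le_add_of_nonneg_right (by positivity))
    have hsecond : ∀ s : State V,
        expectedSize (P {c : V // c ∈ s.clusters} (quotientGraph G s)) ≤
          ENNReal.ofReal (|B| * r) *
            ENNReal.ofReal ((s.clusters.card : ℝ) ^ (1 + 1 / (r : ℝ))) := by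
      intro s
      refine (hP _ (quotientGraph G s)).2.trans ?_
      rw [← ENNReal.ofReal_mul (by positivity), Fintype.card_coe]
      refine ENNReal.ofReal_le_ofReal ?_
      gcongr
      exact le_abs_self B
    calc expectedSize (clusterContraction k t P G)
        ≤ expect (State.iterations (sampleProb (Fintype.card V) k) (sampleProb_le_one _ _) t
            (State.init G)) (fun y => (y.1.spanner.edgeSet.ncard : ℝ≥0∞) +
              ENNReal.ofReal (|B| * r) *
                ENNReal.ofReal ((y.1.clusters.card : ℝ) ^ (1 + 1 / (r : ℝ)))) := by
          refine (expectedSize_clusterContraction_le G k t P).trans (expect_mono _ fun y => ?_)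
          gcongr
          exact hsecond y.1
      _ ≤ (t : ℝ≥0∞) * ENNReal.ofReal (2 * (Fintype.card V : ℝ) ^ (1 + 1 / (k : ℝ))) +
            ENNReal.ofReal (|B| * r) * ENNReal.ofReal (2 * Fintype.card V) := by
          rw [expect_add, expect_const_mul]
          gcongr
          · refine (State.expect_size_iterations_init _ _ _ _).trans ?_
            gcongr
            exact nat_mul_one_add_inv_sampleProb_le _ _
          · exact expect_card_clusters_rpow_le G hk hr1' htr
      _ ≤ _ := by
          set X : ℝ := (Fintype.card V : ℝ) ^ (1 + 1 / (k : ℝ)) with hX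
          have hX0 : 0 ≤ X := hn0.trans hn
          rw [← ENNReal.ofReal_natCast, ← ENNReal.ofReal_mul (Nat.cast_nonneg _),
            ← ENNReal.ofReal_mul (by positivity),
            ← ENNReal.ofReal_add (by positivity) (by positivity)]
          refine ENNReal.ofReal_le_ofReal ?_
          calc (t : ℝ) * (2 * X) + |B| * r * (2 * Fintype.card V)
              ≤ (a * √(k : ℝ)) * (2 * X) + |B| * (a * √(k : ℝ)) * (2 * X) := by gcongr
            _ = (2 * a + 2 * |B| * a) * √(k : ℝ) * X := by ring
            _ ≤ C * √(k : ℝ) * X := by gcongr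

/-- The constant of the main theorem is uniform in the second-phase routine. -/
theorem exists_constant_clusterContraction (a B : ℝ) : ∃ C : ℝ, 0 < C ∧
    ∀ k t r : ℕ, 1 ≤ k →
      √(k : ℝ) ≤ t → (t : ℝ) ≤ a * √(k : ℝ) → √(k : ℝ) ≤ r → (r : ℝ) ≤ a * √(k : ℝ) →
    ∀ P : SpannerRoutine.{u}, P.HasGuarantee B r →
    ∀ (V : Type u) [Fintype V] [LinearOrder V] (G : SimpleGraph V),
      ComputesSpanner G (clusterContraction k t P G) (C * (k : ℝ))
        (C * √(k : ℝ) * (Fintype.card V : ℝ) ^ (1 + 1 / (k : ℝ))) (C * √(k : ℝ)) := by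
  have hB := abs_nonneg B
  have ha : a ≤ |a| := le_abs_self a
  have ha0 := abs_nonneg a
  have hBa : |B| * a ≤ |B| * |a| := mul_le_mul_of_nonneg_left ha hB
  have hBa0 : 0 ≤ |B| * |a| := by positivity
  have ha2 := sq_nonneg a
  -- This dominates the three lower bounds required of `C`; absolute values keep it positive for all
  -- `a` and `B`.
  refine ⟨8 * a ^ 2 + 3 * |a| + 2 + 2 * (|B| * |a|), by positivity, ?_⟩
  intro k t r hk ht hta hr hra P hP V _ _ G
  exact clusterContraction_computesSpanner hk ht hta hr hra hP G (by linarith) (by linarith)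
    (by linarith)

end ClusterSpanner
end

theorem mainTheorem9 :
    -- the second phase runs the Baswana-Sen algorithm
    (∀ a : ℝ, ∃ C : ℝ, 0 < C ∧
      ∀ k t t' : ℕ, 1 ≤ k →
        √(k : ℝ) ≤ t → (t : ℝ) ≤ a * √(k : ℝ) → √(k : ℝ) ≤ t' → (t' : ℝ) ≤ a * √(k : ℝ) →
      ∀ (V : Type u) [Fintype V] [LinearOrder V] (G : SimpleGraph V),
        ClusterSpanner.ComputesSpanner G
          (ClusterSpanner.clusterContraction k t (ClusterSpanner.baswanaSen t') G)
          (C * (k : ℝ))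
          (C * √(k : ℝ) * (Fintype.card V : ℝ) ^ (1 + 1 / (k : ℝ)))
          (C * √(k : ℝ))) ∧
    -- the second phase runs an arbitrary spanner routine with the same kind of guarantee
    (∀ a B : ℝ, ∃ C : ℝ, 0 < C ∧
      ∀ k t t' : ℕ, 1 ≤ k →
        √(k : ℝ) ≤ t → (t : ℝ) ≤ a * √(k : ℝ) → √(k : ℝ) ≤ t' → (t' : ℝ) ≤ a * √(k : ℝ) →
      ∀ P : ClusterSpanner.SpannerRoutine.{u}, P.HasGuarantee B t' →
      ∀ (V : Type u) [Fintype V] [LinearOrder V] (G : SimpleGraph V),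
        ClusterSpanner.ComputesSpanner G
          (ClusterSpanner.clusterContraction k t P G)
          (C * (k : ℝ))
          (C * √(k : ℝ) * (Fintype.card V : ℝ) ^ (1 + 1 / (k : ℝ)))
          (C * √(k : ℝ))) := by
  refine ⟨fun a => ?_, fun a B => ClusterSpanner.exists_constant_clusterContraction a B⟩
  obtain ⟨C, hC, h⟩ := ClusterSpanner.exists_constant_clusterContraction.{u} a 3
  refine ⟨C, hC, fun k t t' hk ht hta ht' hta' V _ _ G => ?_⟩
  have h1 : (1 : ℝ) ≤ t' := (Real.one_le_sqrt.2 (by exact_mod_cast hk)).trans ht'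
  exact h k t t' hk ht hta ht' hta' _
    (ClusterSpanner.baswanaSen_hasGuarantee (by exact_mod_cast h1)) V G
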